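/- For $t\in\mathbb{R}/\mathbb{Z}$ let $\|t\|_{\mathbb{R}/\mathbb{Z}}$ be the distance of $t$ to the nearest integer. For non-zero integers $v_1,\dots,v_n$ let $\delta(v_1,\dots,v_n)=\max_{t\in\mathbb{R}/\mathbb{Z}}\min_{1\le i\le n}\|tv_i\|_{\mathbb{R}/\mathbb{Z}}$, and let $\delta_n$ be the infimum of $\delta(v_1,\dots,v_n)$ over all $n$-tuples of distinct non-zero integers. Say that the lonely runner conjecture holds for $n$ up to $n_0$ if $\delta_n=\frac{1}{n+1}$ for all $1\le n\le n_0$. For every $n_0\ge 1$, whether the lonely runner conjecture holds for $n$ up to $n_0$ is decidable, and its truth value can be computed, by one program of explicitly bounded length, in time $O(n_0^{O(n_0^2)})$. Precisely: 1. The predicate "the lonely runner conjecture holds for $n$ up to $n_0$" of the natural number $n_0$ is computable. 2. There are a LOOP program $P$ consisting of at most $10000$ instructions and a constant $C\in\mathbb{N}$ such that for every $n_0\ge 1$, the program $P$ on input $n_0$ takes at most $C\,n_0^{C n_0^2}$ steps, and it outputs $1$ if the lonely runner conjecture holds for $n$ up to $n_0$, and $0$ if it does not. Here a LOOP program acts on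 registers $R_0,R_1,\dots$ holding natural numbers (the input in $R_0$ and $0$ in all others at the start, the output in $R_1$ at the end). It is built from the instructions $R_x:=0$, $R_x:=R_x+1$, $R_x:=R_y$ by composition and by the instruction "repeat $Q$ as many times as the value of $R_x$ on entry", $Q$ being a LOOP program. Each assignment, each entry into a loop and each passage through a loop counts as one step. -/

import Mathlib

namespace LonelyRunner

/-- `δ(v₁, …, vₙ)`: the maximum over `t ∈ ℝ/ℤ` of `min (‖t v₁‖, …, ‖t vₙ‖)`, where the norm of
`UnitAddCircle = ℝ/ℤ` is the distance to the nearest integer. For `n ≥ 1` this supremum is a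
maximum, `ℝ/ℤ` being compact. -/
noncomputable def delta {n : ℕ} (v : Fin n → ℤ) : ℝ :=
  ⨆ t : UnitAddCircle, ⨅ i : Fin n, ‖v i • t‖

/-- The gap of loneliness `δₙ`: the infimum of `δ(v₁, …, vₙ)` over all `n`-tuples of distinct
non-zero integers. -/
noncomputable def gap (n : ℕ) : ℝ :=
  ⨅ v : {v : Fin n → ℤ // Function.Injective v ∧ ∀ i, v i ≠ 0}, delta v.1

/-- The lonely runner conjecture holds for all `n` up to `n₀`. -/
def HoldsUpTo (n₀ : ℕ) : Prop :=
  ∀ n : ℕ, 1 ≤ n → n ≤ n₀ → gap n = 1 / ((n : ℝ) + 1)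

/-- Programs of the LOOP language, over registers `R₀, R₁, R₂, …` holding natural numbers. -/
inductive LoopProgram : Type
  /-- set `R x` to zero -/
  | zero (x : ℕ) : LoopProgram
  /-- increase `R x` by one -/
  | succ (x : ℕ) : LoopProgram
  /-- `copy x y` sets `R x` to the value of `R y` -/
  | copy (x y : ℕ) : LoopProgram
  /-- run `p`, then `q` -/
  | seq (p q : LoopProgram) : LoopProgram
  /-- run `p` as many times as the value that `R x` has when the loop is entered -/
  | loop (x : ℕ) (p : LoopProgram) : LoopProgram

namespace LoopProgram

/-- The contents of the registers after a run of the program. -/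
def exec : LoopProgram → (ℕ → ℕ) → (ℕ → ℕ)
  | zero x, s => Function.update s x 0
  | succ x, s => Function.update s x (s x + 1)
  | copy x y, s => Function.update s x (s y)
  | seq p q, s => exec q (exec p s)
  | loop x p, s => (exec p)^[s x] s

/-- The number of elementary steps of a run: one for each assignment, one for entering a loop and
one for each passage through a loop, besides the steps of its body. A step raises the largest number
in the registers by at most one, so that no large number can be handled at an unfair price. -/
def steps : LoopProgram → (ℕ → ℕ) → ℕ
  | zero _, _ => 1
  | succ _, _ => 1
  | copy _ _, _ => 1
  | seq p q, s => steps p s + steps q (exec p s)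
  | loop x p, s => 1 + ∑ j ∈ Finset.range (s x), (1 + steps p ((exec p)^[j] s))

/-- The length of the program text: its number of assignments and of loop instructions. -/
def size : LoopProgram → ℕ
  | zero _ => 1
  | succ _ => 1
  | copy _ _ => 1
  | seq p q => size p + size q
  | loop _ p => 1 + size p

/-- The initial contents of the registers: the input in `R₀`, zero in all others. -/
def init (a : ℕ) : ℕ → ℕ := Function.update 0 0 a

/-- The output on input `a`: the final value of `R₁`. -/
def output (p : LoopProgram) (a : ℕ) : ℕ := p.exec (init a) 1

/-- The running time on input `a`. -/
def time (p : LoopProgram) (a : ℕ) : ℕ := p.steps (init a)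

end LoopProgram

end LonelyRunner

/-!
The lonely runner conjecture up to `N` is reduced to finitely many integer checks, and a LOOP program
performs them.

**Bounded speeds** (`lonely_of_large`). Let `S` be a set of `n` positive coprime speeds containing
some `V > Q ^ (n - 1)`, where `Q` is about `n ^ 2`. By the pigeonhole principle some multiple
`(k / V) • S` with `0 < k < V` is within `1 / Q` of an integer point `w`, and `w` is not proportional
to `S` because `V ∤ k`. Take two speeds `a`, `b` whose slopes `w a / a < w b / b` are adjacent among
all slopes `w c / c`. Then `u c = (a + b) * w c - (w a + w b) * c` vanishes for no `c`, as the mediant lies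
strictly between two adjacent slopes, while `u a = - u b`. So the `|u c|` are fewer than `n` positive
speeds, and the conjecture for fewer runners gives a time `τ` at which all `τ * u c` are at distance
at least `1 / n` from the integers. Rounding the coefficient of `w` to an integer turns this into a
time for `S` itself, and since `w` is so close to a multiple of `S` this costs at most
`1 / (2 * Q) ≤ 1 / n - 1 / (n + 1)`. By induction (`lonely_of_bounded`) it suffices to consider speeds
up to `B = (N + 2) ^ (2 * N)`.

**Rational times** (`Lonely.exists_rational`). If a good time exists, going back in time until some
runner `j` is at a multiple of `1 / (n + 1)` yields a good time with denominator `(n + 1) * j`. Hence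
the conjecture up to `N` is equivalent to the bounded arithmetical statement `Check N B`, in which
tuples of speeds are coded by numbers below `B ^ N`.

**The program.** A small language of primitive recursive terms is compiled to LOOP programs
(`compile_spec`), with an exact cost function. Except for the two powers `B` and `B ^ N`, all terms
used have value and cost polynomial in the numbers of their environment (`PolyBounded`), and these
are all at most `(N + 2) ^ O(N ^ 2 + 1)`. As terms denote primitive recursive functions (`primrec_eval`),
the same term also gives computability.
-/

namespace LonelyRunner

/-! ### A term language for primitive recursion and its compilation to LOOP programs -/

/-- Terms denoting primitive recursive functions of an environment, a list of natural numbers.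
Variables are de Bruijn indices; an index beyond the end of the environment denotes `0`. -/
inductive Term : Type
  /-- the entry of the environment at an index -/
  | var (i : ℕ) : Term
  /-- the constant zero -/
  | zero : Term
  /-- successor -/
  | succ (t : Term) : Term
  /-- `bind e t` is `t` in the environment extended by the value of `e` at the front -/
  | bind (e t : Term) : Term
  /-- `app t e f` is `t` in the environment that consists of the values of `e` and `f` only -/
  | app (t e f : Term) : Term
  /-- primitive recursion: `n` rounds starting from `a`; the step `f` sees the round at index `0`
  and the previous value at index `1`, in front of the environment -/
  | recur (n a f : Term) : Term

namespace Term

open LoopProgram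

/-- The value of a term. -/
def eval : Term → List ℕ → ℕ
  | var i, l => l.getD i 0
  | zero, _ => 0
  | succ t, l => eval t l + 1
  | bind e t, l => eval t (eval e l :: l)
  | app t e f, l => eval t [eval e l, eval f l]
  | recur n a f, l => Nat.rec (eval a l) (fun x y => eval f (x :: y :: l)) (eval n l)

/-- The value of the primitive recursion `recur n a f` after `j` rounds. -/
def recurAt (a f : Term) (l : List ℕ) (j : ℕ) : ℕ :=
  Nat.rec (eval a l) (fun x y => eval f (x :: y :: l)) j

/-- The running time of the compiled term. The constants are those of the LOOP instructions that
`compile` inserts around the subterms. -/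
def cost : Term → List ℕ → ℕ
  | var _, _ => 1
  | zero, _ => 1
  | succ t, l => cost t l + 1
  | bind e t, l => cost e l + cost t (eval e l :: l) + 1
  | app t e f, l => cost e l + cost f l + cost t [eval e l, eval f l] + 1
  | recur n a f, l => cost n l + cost a l + 4 +
      ∑ j ∈ Finset.range (eval n l), (cost f (j :: recurAt a f l j :: l) + 3)

/-- The LOOP program for a term. The environment is held in the registers `ρ`, which all lie
below `k`; the value is left in `R k`, the registers above `k` are scratch, and those below `k` are
unchanged. -/
def compile : Term → List ℕ → ℕ → LoopProgram
  | var i, ρ, k => match ρ[i]? with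
    | some r => .copy k r
    | none => .zero k
  | zero, _, k => .zero k
  | succ t, ρ, k => .seq (compile t ρ k) (.succ k)
  | bind e t, ρ, k => .seq (compile e ρ k) (.seq (compile t (k :: ρ) (k + 1)) (.copy k (k + 1)))
  | app t e f, ρ, k => .seq (compile e ρ k) (.seq (compile f ρ (k + 1))
      (.seq (compile t [k, k + 1] (k + 2)) (.copy k (k + 2))))
  | recur n a f, ρ, k => .seq (compile n ρ k) (.seq (compile a ρ (k + 1))
      -- a loop reads its register on entry only, so that the body may use `R (k + 2)` as scratch
      (.seq (.copy (k + 2) k) (.seq (.zero k) (.seq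
        (.loop (k + 2) (.seq (compile f (k :: (k + 1) :: ρ) (k + 2))
          (.seq (.copy (k + 1) (k + 2)) (.succ k))))
        (.copy k (k + 1))))))

theorem map_congr_of_lt {ρ : List ℕ} {k : ℕ} {s s' : ℕ → ℕ} (hρ : ∀ r ∈ ρ, r < k)
    (h : ∀ i < k, s' i = s i) : ρ.map s' = ρ.map s :=
  List.map_congr_left fun r hr => h r (hρ r hr)

/-- The compiled program computes the value, respects the registers below `k`, and takes exactly the
number of steps that `cost` predicts. -/
theorem compile_spec (t : Term) : ∀ (ρ : List ℕ) (k : ℕ) (s : ℕ → ℕ), (∀ r ∈ ρ, r < k) →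
    (compile t ρ k).exec s k = eval t (ρ.map s) ∧
    (∀ i < k, (compile t ρ k).exec s i = s i) ∧
    (compile t ρ k).steps s = cost t (ρ.map s) := by
  induction t with
  | var i =>
    intro ρ k s hρ
    rcases h : ρ[i]? with _ | r
    · simp only [compile, h, eval, cost]
      simp only [exec, steps, Function.update_self]
      refine ⟨?_, fun j hj => Function.update_of_ne hj.ne _ _, trivial⟩
      simp [List.getD, h]
    · simp only [compile, h, eval, cost]
      simp only [exec, steps, Function.update_self]
      refine ⟨?_, fun j hj => Function.update_of_ne hj.ne _ _, trivial⟩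
      simp [List.getD, h]
  | zero =>
    intro ρ k s hρ
    simp only [compile, eval, cost, exec, steps, Function.update_self]
    exact ⟨trivial, fun j hj => Function.update_of_ne hj.ne _ _, trivial⟩
  | succ t ih =>
    intro ρ k s hρ
    obtain ⟨h1, h2, h3⟩ := ih ρ k s hρ
    simp only [compile, eval, cost, exec, steps, Function.update_self, h1, h3]
    exact ⟨trivial, fun j hj => (Function.update_of_ne hj.ne _ _).trans (h2 j hj), trivial⟩
  | bind e t ihe iht =>
    intro ρ k s hρ
    obtain ⟨h1, h2, h3⟩ := ihe ρ k s hρ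
    set s₁ := (compile e ρ k).exec s
    obtain ⟨h4, h5, h6⟩ := iht (k :: ρ) (k + 1) s₁ (by
      simp only [List.mem_cons, forall_eq_or_imp]
      exact ⟨by omega, fun r hr => (hρ r hr).trans (by omega)⟩)
    have hm : (k :: ρ).map s₁ = eval e (ρ.map s) :: ρ.map s := by
      simp [h1, map_congr_of_lt hρ h2]
    rw [hm] at h4 h6
    simp only [compile, eval, cost, exec, steps, Function.update_self]
    refine ⟨h4, fun j hj => ?_, by rw [h3, h6]; ring⟩
    rw [Function.update_of_ne hj.ne, h5 j (by omega), h2 j hj]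
  | app t e f iht ihe ihf =>
    intro ρ k s hρ
    obtain ⟨h1, h2, h3⟩ := ihe ρ k s hρ
    set s₁ := (compile e ρ k).exec s
    obtain ⟨h4, h5, h6⟩ := ihf ρ (k + 1) s₁ fun r hr => (hρ r hr).trans (by omega)
    rw [map_congr_of_lt hρ h2] at h4 h6
    set s₂ := (compile f ρ (k + 1)).exec s₁
    obtain ⟨h7, h8, h9⟩ := iht [k, k + 1] (k + 2) s₂ (by simp)
    have hm : [k, k + 1].map s₂ = [eval e (ρ.map s), eval f (ρ.map s)] := by
      simp [h4, h5 k (by omega), h1]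
    rw [hm] at h7 h9
    simp only [compile, eval, cost, exec, steps, Function.update_self]
    refine ⟨h7, fun j hj => ?_, by rw [h3, h6, h9]; ring⟩
    rw [Function.update_of_ne hj.ne, h8 j (by omega), h5 j (by omega), h2 j hj]
  | recur n a f ihn iha ihf =>
    intro ρ k s hρ
    obtain ⟨h1, h2, h3⟩ := ihn ρ k s hρ
    set s₁ := (compile n ρ k).exec s
    obtain ⟨h4, h5, h6⟩ := iha ρ (k + 1) s₁ fun r hr => (hρ r hr).trans (by omega)
    rw [map_congr_of_lt hρ h2] at h4 h6
    set s₂ := (compile a ρ (k + 1)).exec s₁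
    set s₃ := Function.update (Function.update s₂ (k + 2) (s₂ k)) k 0
    set l := ρ.map s
    set body : LoopProgram := .seq (compile f (k :: (k + 1) :: ρ) (k + 2))
      (.seq (.copy (k + 1) (k + 2)) (.succ k))
    -- the loop invariant
    have inv : ∀ j, ((exec body)^[j] s₃) k = j ∧ ((exec body)^[j] s₃) (k + 1) = recurAt a f l j ∧
        ∀ i < k, ((exec body)^[j] s₃) i = s i := by
      intro j
      induction j with
      | zero =>
        refine ⟨by simp [s₃], ?_, fun i hi => ?_⟩
        · simp [s₃, h4, recurAt]
        · simp only [s₃, Function.iterate_zero, id]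
          rw [Function.update_of_ne hi.ne, Function.update_of_ne (by omega), h5 i (by omega),
            h2 i hi]
      | succ j ih =>
        rw [Function.iterate_succ_apply']
        set u := (exec body)^[j] s₃
        obtain ⟨i1, i2, i3⟩ := ih
        obtain ⟨g1, g2, -⟩ := ihf (k :: (k + 1) :: ρ) (k + 2) u (by
          simp only [List.mem_cons, forall_eq_or_imp]
          exact ⟨by omega, by omega, fun r hr => (hρ r hr).trans (by omega)⟩)
        have hm : (k :: (k + 1) :: ρ).map u = j :: recurAt a f l j :: l := by
          simp [i1, i2, map_congr_of_lt hρ i3, l]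
        rw [hm] at g1
        simp only [body, exec]
        refine ⟨?_, ?_, fun i hi => ?_⟩
        · rw [Function.update_self, Function.update_of_ne (by omega), g2 k (by omega), i1]
        · rw [Function.update_of_ne (by omega), Function.update_self, g1]; rfl
        · rw [Function.update_of_ne hi.ne, Function.update_of_ne (by omega), g2 i (by omega),
            i3 i hi]
    have hst : ∀ j, steps body ((exec body)^[j] s₃) = cost f (j :: recurAt a f l j :: l) + 2 := by
      intro j
      obtain ⟨i1, i2, i3⟩ := inv j
      set u := (exec body)^[j] s₃
      obtain ⟨-, -, g3⟩ := ihf (k :: (k + 1) :: ρ) (k + 2) u (by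
        simp only [List.mem_cons, forall_eq_or_imp]
        exact ⟨by omega, by omega, fun r hr => (hρ r hr).trans (by omega)⟩)
      have hm : (k :: (k + 1) :: ρ).map u = j :: recurAt a f l j :: l := by
        simp [i1, i2, map_congr_of_lt hρ i3, l]
      rw [hm] at g3
      simp only [body, steps, g3]
    have hn : s₃ (k + 2) = eval n l := by
      simp only [s₃]
      rw [Function.update_of_ne (by omega), Function.update_self, h5 k (by omega), h1]
    have hloop : exec (.loop (k + 2) body) s₃ = (exec body)^[eval n l] s₃ := by
      rw [← hn]; rfl
    have hexec : exec (compile (recur n a f) ρ k) s = Function.update ((exec body)^[eval n l] s₃) k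
        (((exec body)^[eval n l] s₃) (k + 1)) := by
      rw [← hloop]; rfl
    refine ⟨?_, fun j hj => ?_, ?_⟩
    · rw [hexec, Function.update_self]; exact (inv _).2.1
    · rw [hexec, Function.update_of_ne hj.ne]; exact (inv _).2.2 j hj
    · change steps (compile n ρ k) s + (steps (compile a ρ (k + 1)) s₁ + (1 + (1 +
        ((1 + ∑ j ∈ Finset.range (s₃ (k + 2)), (1 + steps body ((exec body)^[j] s₃))) + 1)))) = _
      rw [h3, h6, hn, Finset.sum_congr rfl fun j _ => show 1 + steps body ((exec body)^[j] s₃) =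
          cost f (j :: recurAt a f l j :: l) + 3 by rw [hst j]; ring]
      simp only [cost]
      ring

theorem primrec_eval (t : Term) : Primrec (eval t) := by
  induction t with
  | var i =>
    exact (Primrec.list_getD 0).comp Primrec.id (Primrec.const i)
  | zero => exact Primrec.const 0
  | succ t ih => exact Primrec.succ.comp ih
  | bind e t ihe iht => exact iht.comp (Primrec.list_cons.comp ihe Primrec.id)
  | app t e f iht ihe ihf =>
    exact iht.comp (Primrec.list_cons.comp ihe (Primrec.list_cons.comp ihf (Primrec.const [])))
  | recur n a f ihn iha ihf =>
    refine Primrec.nat_rec' ihn iha (h := fun l p => eval f (p.1 :: p.2 :: l)) ?_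
    exact (ihf.comp (Primrec.list_cons.comp (Primrec.fst.comp Primrec.snd)
      (Primrec.list_cons.comp (Primrec.snd.comp Primrec.snd) Primrec.fst))).to₂

/-! ### Polynomially bounded terms -/

/-- The value and the cost of the term are polynomially bounded in the numbers of the
environment. Since `M ≥ 2`, a pure power of `M` is as good as any polynomial. -/
def PolyBounded (t : Term) : Prop :=
  ∃ c : ℕ, ∀ M : ℕ, 2 ≤ M → ∀ l : List ℕ, (∀ x ∈ l, x ≤ M) → eval t l ≤ M ^ c ∧ cost t l ≤ M ^ c

theorem getD_le {l : List ℕ} {M : ℕ} (hl : ∀ x ∈ l, x ≤ M) (i : ℕ) : l.getD i 0 ≤ M := by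
  rw [List.getD_eq_getElem?_getD]
  rcases h : l[i]? with _ | r
  · simp
  · exact hl r (List.mem_of_getElem? h)

theorem PolyBounded.var (i : ℕ) : PolyBounded (var i) := by
  refine ⟨1, fun M hM l hl => ⟨?_, ?_⟩⟩
  · rw [pow_one]
    exact getD_le hl i
  · simp only [cost, pow_one]; omega

theorem PolyBounded.zero : PolyBounded zero :=
  ⟨1, fun M hM l _ => ⟨by simp [eval], by simp only [cost, pow_one]; omega⟩⟩

theorem PolyBounded.succ {t : Term} (ht : PolyBounded t) : PolyBounded (succ t) := by
  obtain ⟨c, hc⟩ := ht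
  refine ⟨c + 1, fun M hM l hl => ?_⟩
  obtain ⟨h1, h2⟩ := hc M hM l hl
  have : 1 ≤ M ^ c := Nat.one_le_pow _ _ (by omega)
  simp only [eval, cost, pow_succ]
  constructor <;> nlinarith

theorem PolyBounded.bind {e t : Term} (he : PolyBounded e) (ht : PolyBounded t) :
    PolyBounded (bind e t) := by
  obtain ⟨c, hc⟩ := he
  obtain ⟨d, hd⟩ := ht
  refine ⟨c + (c + 1) * d + 2, fun M hM l hl => ?_⟩
  obtain ⟨h1, h2⟩ := hc M hM l hl
  have hM1 : M ≤ M ^ (c + 1) := Nat.le_self_pow (by omega) M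
  obtain ⟨h3, h4⟩ := hd (M ^ (c + 1)) (hM.trans hM1) (eval e l :: l) (by
    simp only [List.mem_cons, forall_eq_or_imp]
    exact ⟨h1.trans (Nat.pow_le_pow_right (by omega) (by omega)), fun x hx => (hl x hx).trans hM1⟩)
  rw [← pow_mul] at h3 h4
  have : 1 ≤ M ^ c := Nat.one_le_pow _ _ (by omega)
  have : 1 ≤ M ^ ((c + 1) * d) := Nat.one_le_pow _ _ (by omega)
  have h5 : M ^ c + M ^ ((c + 1) * d) + 1 ≤ M ^ (c + (c + 1) * d + 2) := by
    rw [pow_add, pow_add]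
    have : 4 ≤ M ^ 2 := by nlinarith
    nlinarith [mul_le_mul' (le_refl (M ^ c * M ^ ((c + 1) * d))) this,
      Nat.mul_le_mul ‹1 ≤ M ^ c› (le_refl (M ^ ((c + 1) * d))),
      Nat.mul_le_mul (le_refl (M ^ c)) ‹1 ≤ M ^ ((c + 1) * d)›]
  simp only [eval, cost]
  omega

theorem PolyBounded.app {t e f : Term} (ht : PolyBounded t) (he : PolyBounded e)
    (hf : PolyBounded f) : PolyBounded (app t e f) := by
  obtain ⟨c₁, hc₁⟩ := he
  obtain ⟨c₂, hc₂⟩ := hf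
  obtain ⟨d, hd⟩ := ht
  obtain ⟨c, hcd⟩ : ∃ c, c = c₁ + c₂ + 1 := ⟨_, rfl⟩
  refine ⟨c + c * d + 2, fun M hM l hl => ?_⟩
  obtain ⟨h1, h2⟩ := hc₁ M hM l hl
  obtain ⟨h1', h2'⟩ := hc₂ M hM l hl
  have hM1 : M ≤ M ^ c := Nat.le_self_pow (by omega) M
  have m1 : M ^ c₁ ≤ M ^ c := Nat.pow_le_pow_right (by omega) (by omega)
  have m2 : M ^ c₂ ≤ M ^ c := Nat.pow_le_pow_right (by omega) (by omega)
  obtain ⟨h3, h4⟩ := hd (M ^ c) (hM.trans hM1) [eval e l, eval f l] (by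
    simp only [List.mem_cons, forall_eq_or_imp, List.not_mem_nil, false_imp_iff, implies_true,
      and_true]
    exact ⟨h1.trans m1, h1'.trans m2⟩)
  rw [← pow_mul] at h3 h4
  have o1 : 1 ≤ M ^ c := Nat.one_le_pow _ _ (by omega)
  have o2 : 1 ≤ M ^ (c * d) := Nat.one_le_pow _ _ (by omega)
  have h5 : 2 * M ^ c + M ^ (c * d) + 1 ≤ M ^ (c + c * d + 2) := by
    rw [pow_add, pow_add]
    have : 4 ≤ M ^ 2 := by nlinarith
    nlinarith [mul_le_mul' (le_refl (M ^ c * M ^ (c * d))) this,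
      Nat.mul_le_mul o1 (le_refl (M ^ (c * d))), Nat.mul_le_mul (le_refl (M ^ c)) o2]
  simp only [eval, cost]
  omega

/-- A primitive recursion is polynomially bounded if its constituents are and if, in addition, all
its intermediate values are. -/
theorem PolyBounded.recur {n a f : Term} (hn : PolyBounded n) (ha : PolyBounded a)
    (hf : PolyBounded f) (h : ∃ c : ℕ, ∀ M : ℕ, 2 ≤ M → ∀ l : List ℕ, (∀ x ∈ l, x ≤ M) →
      ∀ j ≤ eval n l, recurAt a f l j ≤ M ^ c) : PolyBounded (recur n a f) := by
  obtain ⟨c₁, hc₁⟩ := hn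
  obtain ⟨c₂, hc₂⟩ := ha
  obtain ⟨c₃, hc₃⟩ := h
  obtain ⟨d, hd⟩ := hf
  obtain ⟨c, hcd⟩ : ∃ c, c = c₁ + c₂ + c₃ + 1 := ⟨_, rfl⟩
  refine ⟨c + c * d + 5, fun M hM l hl => ?_⟩
  obtain ⟨h1, h2⟩ := hc₁ M hM l hl
  obtain ⟨h1', h2'⟩ := hc₂ M hM l hl
  have hM1 : M ≤ M ^ c := Nat.le_self_pow (by omega) M
  have m1 : M ^ c₁ ≤ M ^ c := Nat.pow_le_pow_right (by omega) (by omega)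
  have m2 : M ^ c₂ ≤ M ^ c := Nat.pow_le_pow_right (by omega) (by omega)
  have m3 : M ^ c₃ ≤ M ^ c := Nat.pow_le_pow_right (by omega) (by omega)
  have o1 : 1 ≤ M ^ c := Nat.one_le_pow _ _ (by omega)
  have o2 : 1 ≤ M ^ (c * d) := Nat.one_le_pow _ _ (by omega)
  have h3 : ∑ j ∈ Finset.range (eval n l), (cost f (j :: recurAt a f l j :: l) + 3) ≤
      M ^ c * (M ^ (c * d) + 3) := by
    calc _ ≤ ∑ j ∈ Finset.range (eval n l), (M ^ (c * d) + 3) := by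
          refine Finset.sum_le_sum fun j hj => ?_
          have hj' : j < eval n l := Finset.mem_range.1 hj
          have := (hd (M ^ c) (hM.trans hM1) (j :: recurAt a f l j :: l) (by
            simp only [List.mem_cons, forall_eq_or_imp]
            exact ⟨by omega, (hc₃ M hM l hl j hj'.le).trans m3,
              fun x hx => (hl x hx).trans hM1⟩)).2
          rw [← pow_mul] at this
          omega
      _ = eval n l * (M ^ (c * d) + 3) := by simp
      _ ≤ _ := Nat.mul_le_mul_right _ (h1.trans m1)
  have h4 : 2 * M ^ c + 4 + M ^ c * (M ^ (c * d) + 3) ≤ M ^ (c + c * d + 5) := by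
    rw [pow_add, pow_add]
    have : 2 ^ 5 ≤ M ^ 5 := Nat.pow_le_pow_left hM 5
    nlinarith [mul_le_mul' (le_refl (M ^ c * M ^ (c * d))) this,
      Nat.mul_le_mul o1 (le_refl (M ^ (c * d))), Nat.mul_le_mul (le_refl (M ^ c)) o2]
  have h5 : eval (Term.recur n a f) l ≤ M ^ c := (hc₃ M hM l hl _ le_rfl).trans m3
  refine ⟨h5.trans (Nat.pow_le_pow_right (by omega) (by omega)), ?_⟩
  simp only [cost]
  omega

end Term

/-! ### Reduction to bounded speeds -/

/-- There is a time at which all runners with speeds in `S` are at distance at least `c` from the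
origin of `ℝ/ℤ`. -/
def Lonely (S : Finset ℕ) (c : ℝ) : Prop :=
  ∃ t : ℝ, ∀ v ∈ S, c ≤ ‖((t * v : ℝ) : UnitAddCircle)‖

theorem Lonely.mono {S T : Finset ℕ} {c d : ℝ} (h : Lonely T d) (hS : S ⊆ T) (hc : c ≤ d) :
    Lonely S c :=
  h.imp fun _ ht v hv => hc.trans (ht v (hS hv))

theorem le_norm_coe_iff {c x : ℝ} :
    c ≤ ‖(x : UnitAddCircle)‖ ↔ c ≤ Int.fract x ∧ c ≤ 1 - Int.fract x := by
  rw [UnitAddCircle.norm_eq, abs_sub_round_eq_min, le_min_iff]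

theorem norm_coe_le (x : ℝ) : ‖(x : UnitAddCircle)‖ ≤ |x| := by
  rw [UnitAddCircle.norm_eq]
  simpa using round_le x 0

theorem coe_add_int (x : ℝ) (m : ℤ) : ((x + m : ℝ) : UnitAddCircle) = x := by
  have : ((m : ℝ) : UnitAddCircle) = 0 :=
    (AddCircle.coe_eq_zero_iff 1).2 ⟨m, by simp⟩
  rw [AddCircle.coe_add, this, add_zero]

theorem norm_coe_mul_natAbs (t : ℝ) (m : ℤ) :
    ‖((t * (m.natAbs : ℕ) : ℝ) : UnitAddCircle)‖ = ‖((t * m : ℝ) : UnitAddCircle)‖ := by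
  rcases Int.natAbs_eq m with h | h
  · conv_rhs => rw [h]
    simp
  · conv_rhs => rw [h]
    rw [Int.cast_neg, mul_neg, AddCircle.coe_neg, norm_neg]
    simp

/-- Dirichlet's simultaneous approximation along the multiples of `1 / V`: for some `0 < k < V` the
point `(k / V) • S` is close to an integer point `w`. -/
theorem exists_simultaneous_approx {S : Finset ℕ} {V Q : ℕ} (hV : V ∈ S) (hQ : 0 < Q)
    (h : Q ^ (S.card - 1) < V) : ∃ k : ℕ, 0 < k ∧ k < V ∧ ∃ w : ℕ → ℤ, w V = k ∧
      ∀ v ∈ S, Q * |(k * v - V * w v : ℤ)| ≤ V := by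
  have hV0 : 0 < V := by omega
  let f : Fin V → (↥(S.erase V) → Fin Q) := fun j i =>
    ⟨(Q * ((j * i) % V)) / V, by
      rw [Nat.div_lt_iff_lt_mul hV0]
      exact Nat.mul_lt_mul_of_pos_left (Nat.mod_lt _ hV0) hQ⟩
  have main : ∃ j j' : Fin V, j < j' ∧ f j = f j' := by
    obtain ⟨j, j', hne, hf⟩ := Fintype.exists_ne_map_eq_of_card_lt f (by
      simpa [Finset.card_erase_of_mem hV] using h)
    rcases lt_or_gt_of_ne hne with hlt | hlt
    · exact ⟨j, j', hlt, hf⟩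
    · exact ⟨j', j, hlt, hf.symm⟩
  obtain ⟨j, j', hlt, hf⟩ := main
  have hlt' : (j : ℕ) < j' := hlt
  refine ⟨j' - j, by omega, by omega, fun v => ((j' * v / V : ℕ) : ℤ) - ((j * v / V : ℕ) : ℤ),
    ?_, fun v hv => ?_⟩
  · simp only [Nat.mul_div_cancel _ hV0]
    push_cast [hlt'.le]
    ring
  have e1 : ((j' * v / V : ℕ) : ℤ) * V + ((j' * v % V : ℕ) : ℤ) = j' * v := by
    exact_mod_cast Nat.div_add_mod' _ _
  have e2 : ((j * v / V : ℕ) : ℤ) * V + ((j * v % V : ℕ) : ℤ) = j * v := by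
    exact_mod_cast Nat.div_add_mod' _ _
  have e3 : (((j' - j : ℕ) : ℤ) * v - V * (((j' * v / V : ℕ) : ℤ) - ((j * v / V : ℕ) : ℤ)) : ℤ) =
      ((j' * v % V : ℕ) : ℤ) - ((j * v % V : ℕ) : ℤ) := by
    push_cast only [hlt'.le, Nat.cast_sub]
    linear_combination e2 - e1
  rw [e3]
  by_cases hvV : v = V
  · subst hvV
    simp
  have hfv : (Q * ((j * v) % V)) / V = (Q * ((j' * v) % V)) / V :=
    congrArg Fin.val (congrFun hf ⟨v, Finset.mem_erase.2 ⟨hvV, hv⟩⟩)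
  set a := j * v % V
  set a' := j' * v % V
  have h1 := Nat.div_add_mod (Q * a) V
  have h2 := Nat.div_add_mod (Q * a') V
  have h3 := Nat.mod_lt (Q * a) hV0
  have h4 := Nat.mod_lt (Q * a') hV0
  rw [hfv] at h1
  rw [← Nat.abs_cast Q, ← abs_mul, abs_le]
  zify at h1 h2 h3 h4
  have h5 : (0 : ℤ) ≤ (Q : ℤ) * a % V := Int.emod_nonneg _ (by omega)
  have h6 : (0 : ℤ) ≤ (Q : ℤ) * a' % V := Int.emod_nonneg _ (by omega)
  rw [mul_sub]
  constructor <;> linarith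

theorem exists_adjacent_values {α : Type*} (S : Finset α) (σ : α → ℚ)
    (h : ∃ x ∈ S, ∃ y ∈ S, σ x ≠ σ y) :
    ∃ a ∈ S, ∃ b ∈ S, σ a < σ b ∧ ∀ c ∈ S, σ c ≤ σ a ∨ σ b ≤ σ c := by
  obtain ⟨x, hx, y, hy, hxy⟩ := h
  obtain ⟨a, ha, hmin⟩ := S.exists_min_image σ ⟨x, hx⟩
  have hne : (S.filter fun c => σ a < σ c).Nonempty := by
    by_contra hcon
    rw [Finset.not_nonempty_iff_eq_empty, Finset.filter_eq_empty_iff] at hcon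
    exact hxy ((le_antisymm (not_lt.1 (hcon hx)) (hmin x hx)).trans
      (le_antisymm (not_lt.1 (hcon hy)) (hmin y hy)).symm)
  obtain ⟨b, hb, hbmin⟩ := Finset.exists_min_image _ σ hne
  rw [Finset.mem_filter] at hb
  refine ⟨a, ha, b, hb.1, hb.2, fun c hc => ?_⟩
  rcases le_or_gt (σ c) (σ a) with hca | hca
  · exact Or.inl hca
  · exact Or.inr (hbmin c (Finset.mem_filter.2 ⟨hc, hca⟩))

/-- If the conjecture holds for fewer runners, then it holds for coprime speeds one of which is
large. -/
theorem lonely_of_large {S : Finset ℕ} (h0 : 0 ∉ S) (hgcd : S.gcd id = 1) {V Q : ℕ} (hV : V ∈ S)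
    (hQ : S.card * (S.card + 1) ≤ 2 * Q) (hVQ : Q ^ (S.card - 1) < V)
    (ih : ∀ S' : Finset ℕ, 0 ∉ S' → S'.Nonempty → S'.card < S.card →
      Lonely S' (1 / ((S'.card : ℝ) + 1))) :
    Lonely S (1 / ((S.card : ℝ) + 1)) := by
  have hcard : 0 < S.card := Finset.card_pos.2 ⟨V, hV⟩
  have hQ0 : 0 < Q := by nlinarith
  have hpos : ∀ v ∈ S, 0 < v := fun v hv => Nat.pos_of_ne_zero fun h => h0 (h ▸ hv)
  have hV0 : 0 < V := hpos V hV
  obtain ⟨k, hk0, hkV, w, hwV, hw⟩ := exists_simultaneous_approx hV hQ0 hVQ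
  -- `w` is not proportional to the identity: otherwise `V` would divide `k`
  have hslope : ∃ x ∈ S, ∃ y ∈ S, (w x : ℚ) / x ≠ (w y : ℚ) / y := by
    by_contra! hcon
    have hdvd : V ∣ S.gcd fun v => k * v := by
      refine Finset.dvd_gcd fun v hv => ?_
      have := hcon V hV v hv
      have hv0 : (v : ℚ) ≠ 0 := by exact_mod_cast (hpos v hv).ne'
      have hV0' : (V : ℚ) ≠ 0 := by exact_mod_cast hV0.ne'
      rw [div_eq_div_iff hV0' hv0, hwV] at this
      have h1 : (k * v : ℤ) = V * w v := by
        have : ((k * v : ℤ) : ℚ) = ((V * w v : ℤ) : ℚ) := by push_cast; push_cast at this; linarith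
        exact_mod_cast this
      exact Int.natCast_dvd_natCast.1 ⟨w v, by exact_mod_cast h1⟩
    rw [Finset.gcd_mul_left] at hdvd
    have hg : (S.gcd fun v => v) = 1 := hgcd
    rw [hg] at hdvd
    simp at hdvd
    exact absurd (Nat.le_of_dvd hk0 hdvd) (by omega)
  obtain ⟨a, ha, b, hb, hab, hadj⟩ := exists_adjacent_values S (fun v => (w v : ℚ) / v) hslope
  have ha0 : (0 : ℚ) < a := by exact_mod_cast hpos a ha
  have hb0 : (0 : ℚ) < b := by exact_mod_cast hpos b hb
  rw [div_lt_div_iff₀ ha0 hb0] at hab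
  -- the mediant of two adjacent slopes is not a slope
  set u : ℕ → ℤ := fun c => (a + b) * w c - (w a + w b) * c
  have hu : ∀ c ∈ S, u c ≠ 0 := by
    intro c hc huc
    have hc0 : (0 : ℚ) < c := by exact_mod_cast hpos c hc
    have hucq : ((a : ℚ) + b) * w c - (w a + w b) * c = 0 := by exact_mod_cast huc
    rcases hadj c hc with h | h
    · rw [div_le_div_iff₀ hc0 ha0] at h
      nlinarith [mul_pos ha0 hc0, mul_le_mul_of_nonneg_right h hb0.le,
        mul_lt_mul_of_pos_right hab hc0]
    · rw [div_le_div_iff₀ hb0 hc0] at h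
      nlinarith [mul_pos ha0 hc0, mul_le_mul_of_nonneg_right h ha0.le,
        mul_lt_mul_of_pos_right hab hc0]
  have huab : u a = -u b := by simp only [u]; ring
  have hne : a ≠ b := by
    rintro rfl
    exact lt_irrefl _ hab
  set S' := S.image fun c => (u c).natAbs
  have hS'card : S'.card < S.card := by
    refine lt_of_le_of_ne Finset.card_image_le fun h => hne ?_
    exact Finset.card_image_iff.1 h ha hb (by simp [huab])
  have hS'0 : 0 ∉ S' := by
    intro h
    obtain ⟨c, hc, hc0⟩ := Finset.mem_image.1 h
    exact hu c hc (Int.natAbs_eq_zero.1 hc0)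
  obtain ⟨τ, hτ⟩ := ih S' hS'0 ⟨_, Finset.mem_image_of_mem _ hV⟩ hS'card
  have hτ' : ∀ c ∈ S, 1 / (S.card : ℝ) ≤ ‖((τ * u c : ℝ) : UnitAddCircle)‖ := by
    intro c hc
    rw [← norm_coe_mul_natAbs]
    refine le_trans ?_ (hτ _ (Finset.mem_image_of_mem _ hc))
    apply one_div_le_one_div_of_le (by positivity)
    exact_mod_cast hS'card
  -- the coefficient `r` of `w` is rounded to an integer, which costs at most `1 / (2 * Q)`
  set r : ℝ := τ * (a + b)
  have hVr : (0 : ℝ) < V := by exact_mod_cast hV0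
  have hQr : (0 : ℝ) < Q := by exact_mod_cast hQ0
  refine ⟨(r - round r) * (k / V) - τ * (w a + w b), fun c hc => ?_⟩
  set s : ℝ := (r - round r) * (k / V) - τ * (w a + w b)
  set e : ℝ := (r - round r) * (w c - k * c / V)
  have hdecomp : τ * u c = (s * c + e) + ((round r * w c : ℤ) : ℝ) := by
    simp only [u, s, e, r]
    push_cast
    ring
  have he : |e| ≤ 1 / (2 * Q) := by
    have h1 : |r - round r| ≤ 1 / 2 := abs_sub_round r
    have h2 : |(w c - k * c / V : ℝ)| ≤ 1 / Q := by
      have h3 : (w c - k * c / V : ℝ) = -((k * c - V * w c : ℤ) : ℝ) / V := by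
        push_cast
        field_simp
        ring
      rw [h3, abs_div, abs_neg, abs_of_pos hVr, div_le_div_iff₀ hVr hQr, one_mul, mul_comm]
      exact_mod_cast hw c hc
    calc |e| = |r - round r| * |(w c - k * c / V : ℝ)| := abs_mul _ _
      _ ≤ 1 / 2 * (1 / Q) := mul_le_mul h1 h2 (abs_nonneg _) (by norm_num)
      _ = _ := by field_simp
  have h1 := hτ' c hc
  rw [hdecomp, coe_add_int, AddCircle.coe_add] at h1
  have h2 := (h1.trans (norm_add_le _ _)).trans (add_le_add_right (norm_coe_le e) _)
  have h3 : 1 / ((S.card : ℝ) + 1) + 1 / (2 * Q) ≤ 1 / (S.card : ℝ) := by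
    have hn : (0 : ℝ) < S.card := by exact_mod_cast hcard
    have h4 : 1 / (2 * Q : ℝ) ≤ 1 / ((S.card : ℝ) * (S.card + 1)) :=
      one_div_le_one_div_of_le (by positivity) (by exact_mod_cast hQ)
    have h5 : 1 / (S.card : ℝ) - 1 / ((S.card : ℝ) + 1) = 1 / ((S.card : ℝ) * (S.card + 1)) := by
      field_simp
      ring
    linarith
  linarith

/-- The conjecture for all sets of at most `N` speeds follows from its instances with speeds up to
a bound `B`. -/
theorem lonely_of_bounded {N B : ℕ} (hB : ∀ n ≤ N, ((n + 1) ^ 2) ^ (n - 1) ≤ B)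
    (h : ∀ S : Finset ℕ, 0 ∉ S → S.Nonempty → S.card ≤ N → (∀ v ∈ S, v ≤ B) →
      Lonely S (1 / ((S.card : ℝ) + 1))) (S : Finset ℕ) (h0 : 0 ∉ S) (hne : S.Nonempty)
    (hN : S.card ≤ N) : Lonely S (1 / ((S.card : ℝ) + 1)) := by
  induction hn : S.card using Nat.strong_induction_on generalizing S with
  | _ n ih =>
    subst hn
    obtain ⟨g, hg, hg1⟩ := Finset.extract_gcd (id : ℕ → ℕ) hne
    set d := S.gcd id
    set T := S.image g
    have hd : d ≠ 0 := by
      intro hd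
      obtain ⟨v, hv⟩ := hne
      have := hg v hv
      rw [hd, zero_mul] at this
      exact h0 ((show v = 0 from this) ▸ hv)
    have hcard : T.card = S.card := Finset.card_image_of_injOn fun x hx y hy hxy => by
      have hx' : x = d * g x := hg x hx
      have hy' : y = d * g y := hg y hy
      rw [hx', hy', show g x = g y from hxy]
    have hT0 : 0 ∉ T := by
      intro hT
      obtain ⟨v, hv, hv0⟩ := Finset.mem_image.1 hT
      have : v = d * g v := hg v hv
      rw [hv0, mul_zero] at this
      exact h0 (this ▸ hv)
    have hTgcd : T.gcd id = 1 := by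
      rw [Finset.gcd_image]
      exact hg1
    have hTL : Lonely T (1 / ((T.card : ℝ) + 1)) := by
      by_cases hbig : ∃ V ∈ T, B < V
      · obtain ⟨V, hV, hBV⟩ := hbig
        refine lonely_of_large (Q := (T.card + 1) ^ 2) hT0 hTgcd hV (by nlinarith)
          ((hB _ (hcard ▸ hN)).trans_lt hBV) fun S' h0' hne' hlt => ?_
        exact ih _ (hcard ▸ hlt) S' h0' hne' (by omega) rfl
      · push Not at hbig
        exact h T hT0 (hne.image g) (hcard ▸ hN) hbig
    rw [hcard] at hTL
    obtain ⟨t, ht⟩ := hTL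
    refine ⟨t / d, fun v hv => ?_⟩
    have hv' : v = d * g v := hg v hv
    have := ht (g v) (Finset.mem_image_of_mem g hv)
    rwa [show (t / d * v : ℝ) = t * g v by
      conv_lhs => rw [hv']
      push_cast
      field_simp]

/-! ### The conjecture as a statement about finite sets of speeds -/

theorem le_delta_iff {n : ℕ} (hn : 0 < n) (v : Fin n → ℤ) (c : ℝ) :
    c ≤ delta v ↔ ∃ t : ℝ, ∀ i, c ≤ ‖((t * v i : ℝ) : UnitAddCircle)‖ := by
  have : Nonempty (Fin n) := ⟨⟨0, hn⟩⟩
  have hcont : Continuous fun t : UnitAddCircle => ⨅ i : Fin n, ‖v i • t‖ := by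
    simp only [← Finset.inf'_univ_eq_ciInf]
    exact Continuous.finset_inf'_apply _ fun i _ => (continuous_zsmul (v i)).norm
  have hcoe : ∀ (t : ℝ) (i : Fin n),
      ‖v i • (t : UnitAddCircle)‖ = ‖((t * v i : ℝ) : UnitAddCircle)‖ := fun t i => by
    rw [← AddCircle.coe_zsmul, zsmul_eq_mul, mul_comm]
  constructor
  · intro h
    obtain ⟨t, -, ht⟩ := isCompact_univ.exists_isMaxOn Set.univ_nonempty hcont.continuousOn
    obtain ⟨t, rfl⟩ := QuotientAddGroup.mk_surjective t
    refine ⟨t, fun i => ?_⟩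
    rw [← hcoe]
    exact (h.trans (ciSup_le fun s => ht (Set.mem_univ s))).trans
      (ciInf_le (Set.finite_range _).bddBelow i)
  · rintro ⟨t, ht⟩
    refine le_trans (le_ciInf fun i => ?_)
      (le_ciSup (isCompact_range hcont).bddAbove (t : UnitAddCircle))
    rw [hcoe]
    exact ht i

theorem delta_nonneg {n : ℕ} (v : Fin n → ℤ) : 0 ≤ delta v :=
  Real.iSup_nonneg fun _ => Real.iInf_nonneg fun _ => norm_nonneg _

/-- The speeds `1, …, n` do not do better than `1 / (n + 1)`, by Dirichlet's theorem. -/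
theorem gap_le {n : ℕ} (hn : 0 < n) : gap n ≤ 1 / ((n : ℝ) + 1) := by
  refine (ciInf_le ⟨0, ?_⟩ (⟨fun i : Fin n => (i : ℤ) + 1, ?_, ?_⟩ :
    {v : Fin n → ℤ // Function.Injective v ∧ ∀ i, v i ≠ 0})).trans ?_
  · rintro _ ⟨v, rfl⟩
    exact delta_nonneg _
  · intro i j hij
    simpa [Fin.ext_iff] using hij
  · intro i
    positivity
  · obtain ⟨t, ht⟩ := (le_delta_iff hn _ _).1 (le_refl (delta fun i : Fin n => (i : ℤ) + 1))
    obtain ⟨j, k, hk0, hkn, hjk⟩ := Real.exists_int_int_abs_mul_sub_le t hn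
    have h1 := ht ⟨k.toNat - 1, by omega⟩
    have h2 : (((k.toNat - 1 : ℕ) : ℤ) + 1 : ℤ) = k := by omega
    simp only [h2] at h1
    have h3 : t * k = (k * t - j : ℝ) + j := by ring
    rw [h3, coe_add_int] at h1
    exact (h1.trans (norm_coe_le _)).trans hjk

theorem holdsUpTo_iff_lonely (N : ℕ) : HoldsUpTo N ↔ ∀ S : Finset ℕ, 0 ∉ S → S.Nonempty →
    S.card ≤ N → Lonely S (1 / ((S.card : ℝ) + 1)) := by
  constructor
  · intro h S h0 hne hN
    have hcard : 0 < S.card := hne.card_pos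
    have hgap := h S.card hcard hN
    let v : Fin S.card → ℤ := fun i => (S.equivFin.symm i : ℕ)
    have hv : Function.Injective v ∧ ∀ i, v i ≠ 0 := by
      refine ⟨fun i j hij => ?_, fun i hi => h0 ?_⟩
      · exact S.equivFin.symm.injective (Subtype.ext (Int.ofNat.inj hij))
      · have : (S.equivFin.symm i : ℕ) = 0 := Int.natCast_eq_zero.1 hi
        exact this ▸ (S.equivFin.symm i).2
    have hle : gap S.card ≤ delta v := ciInf_le (ι := {v : Fin S.card → ℤ //
      Function.Injective v ∧ ∀ i, v i ≠ 0}) ⟨0, by rintro _ ⟨v, rfl⟩; exact delta_nonneg _⟩ ⟨v, hv⟩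
    rw [hgap, le_delta_iff hcard] at hle
    obtain ⟨t, ht⟩ := hle
    refine ⟨t, fun x hx => ?_⟩
    simpa [v] using ht (S.equivFin ⟨x, hx⟩)
  · intro h n hn hN
    refine le_antisymm (gap_le hn) ?_
    have : Nonempty {v : Fin n → ℤ // Function.Injective v ∧ ∀ i, v i ≠ 0} :=
      ⟨⟨fun i => (i : ℤ) + 1, fun i j hij => by simpa [Fin.ext_iff] using hij,
        fun i => by positivity⟩⟩
    refine le_ciInf fun ⟨v, _, hv0⟩ => ?_
    rw [le_delta_iff hn]
    have hcard : (Finset.univ.image fun i => (v i).natAbs).card ≤ n := by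
      simpa using Finset.card_image_le (s := Finset.univ) (f := fun i => (v i).natAbs)
    obtain ⟨t, ht⟩ := (h (Finset.univ.image fun i => (v i).natAbs) (by simpa using hv0)
      ⟨_, Finset.mem_image_of_mem _ (Finset.mem_univ ⟨0, hn⟩)⟩ (hcard.trans hN)).mono le_rfl
      (one_div_le_one_div_of_le (by positivity) (by gcongr : _ ≤ (n : ℝ) + 1))
    refine ⟨t, fun i => ?_⟩
    rw [← norm_coe_mul_natAbs]
    exact ht _ (Finset.mem_image_of_mem _ (Finset.mem_univ i))

/-! ### Reduction to rational times -/

theorem le_norm_coe_div_iff {n T : ℕ} (hT : 0 < T) (a : ℕ) :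
    1 / ((n : ℝ) + 1) ≤ ‖((a / T : ℝ) : UnitAddCircle)‖ ↔
      T ≤ (n + 1) * (a % T) ∧ (n + 1) * (a % T) ≤ n * T := by
  have hTr : (0 : ℝ) < T := by exact_mod_cast hT
  have hn : (0 : ℝ) < (n : ℝ) + 1 := by positivity
  rw [le_norm_coe_iff, Int.fract_div_natCast_eq_div_natCast_mod]
  refine and_congr ?_ ?_
  · rw [div_le_div_iff₀ hn hTr, one_mul, mul_comm]
    exact_mod_cast Iff.rfl
  · rw [le_sub_comm, div_le_iff₀ hTr]
    have : (1 - 1 / ((n : ℝ) + 1)) * T = (n * T) / (n + 1) := by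
      field_simp
      ring
    rw [this, le_div_iff₀ hn, mul_comm]
    exact_mod_cast Iff.rfl

/-- If there is a suitable time, then there is one at which some runner is at a multiple of
`1 / (n + 1)`: go back in time until this happens. -/
theorem Lonely.exists_rational {S : Finset ℕ} {n : ℕ} (h0 : 0 ∉ S) (hne : S.Nonempty)
    (h : Lonely S (1 / ((n : ℝ) + 1))) : ∃ j ∈ S, ∃ t < (n + 1) * j, ∀ v ∈ S,
      (n + 1) * j ≤ (n + 1) * (t * v % ((n + 1) * j)) ∧
        (n + 1) * (t * v % ((n + 1) * j)) ≤ n * ((n + 1) * j) := by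
  obtain ⟨τ, hτ⟩ := h
  have hpos : ∀ v ∈ S, 0 < v := fun v hv => Nat.pos_of_ne_zero fun h => h0 (h ▸ hv)
  have hn : (0 : ℝ) < (n : ℝ) + 1 := by positivity
  obtain ⟨j, hj, hmax⟩ := S.exists_max_image
    (fun v => (⌊(n + 1) * v * τ⌋ : ℝ) / ((n + 1) * v)) hne
  set p : ℤ := ⌊(n + 1) * j * τ⌋
  set T : ℕ := (n + 1) * j
  have hTpos : 0 < T := Nat.mul_pos (by omega) (hpos j hj)
  have hTr : (0 : ℝ) < T := by exact_mod_cast hTpos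
  have hTcast : ((n + 1) * j : ℝ) = T := by simp [T]
  have hle : (p : ℝ) / T ≤ τ := by
    rw [div_le_iff₀ hTr, mul_comm, ← hTcast]
    exact Int.floor_le _
  refine ⟨j, hj, (p % T).toNat, ?_, fun v hv => ?_⟩
  · have := Int.emod_lt_of_pos p (by exact_mod_cast hTpos : (0 : ℤ) < T)
    have := Int.emod_nonneg p (by omega : (T : ℤ) ≠ 0)
    omega
  rw [← le_norm_coe_div_iff hTpos]
  have hvr : (0 : ℝ) < v := by exact_mod_cast hpos v hv
  have hmod : ((((p % T).toNat * v : ℕ) : ℝ) / T) = p / T * v + ((-(p / T) * v : ℤ) : ℝ) := by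
    have h1 : (((p % T).toNat : ℤ) : ℝ) = p - T * ((p / T : ℤ) : ℝ) := by
      rw [Int.toNat_of_nonneg (Int.emod_nonneg p (by omega)), Int.emod_def]
      push_cast
      ring
    rw [Int.cast_natCast] at h1
    push_cast
    rw [h1]
    field_simp
    ring
  rw [hmod, coe_add_int]
  -- between the times `p / T` and `τ`, no runner passes a multiple of `1 / (n + 1)`
  have hlow : (⌊(n + 1) * v * τ⌋ : ℝ) ≤ (n + 1) * (p / T * v) := by
    have := hmax v hv
    rw [hTcast, div_le_iff₀ (by positivity)] at this
    linarith
  have hhigh : p / T * v ≤ τ * v := mul_le_mul_of_nonneg_right hle hvr.le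
  obtain ⟨h1, h2⟩ := le_norm_coe_iff.1 (hτ v hv)
  set q := ⌊τ * v⌋
  rw [Int.fract] at h1 h2
  have hfl : (n + 1) * q + 1 ≤ ⌊(n + 1) * v * τ⌋ := by
    rw [Int.le_floor]
    rw [div_le_iff₀ hn] at h1
    push_cast
    linarith
  have h3 : ((n + 1) * q + 1 : ℝ) ≤ (n + 1) * (p / T * v) := by
    refine le_trans ?_ hlow
    exact_mod_cast hfl
  have h4 : 1 / ((n : ℝ) + 1) ≤ p / T * v - q := by
    rw [div_le_iff₀ hn]
    linarith
  have h5 : ⌊(p / T * v : ℝ)⌋ = q := by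
    rw [Int.floor_eq_iff]
    have : 0 < 1 / ((n : ℝ) + 1) := by positivity
    constructor <;> linarith
  rw [le_norm_coe_iff, Int.fract, h5]
  exact ⟨h4, by linarith⟩

/-- The arithmetical condition that the program checks, with speeds up to `B`. The tuples of at most
`N` speeds are coded by the numbers below `B ^ N`: the speeds are the digits in base `B`, increased
by one. There are `n + 1` speeds, so that the distance required is `1 / (n + 2)`. The times are the
fractions `t / T`. -/
def Check (N B : ℕ) : Prop :=
  ∀ n < N, ∀ m < B ^ N, ∃ T < (N + 2) * B, ∃ t < T, ∀ i < n + 1,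
    T ≤ (n + 2) * ((t * (m / B ^ i % B + 1)) % T) ∧
      (n + 2) * ((t * (m / B ^ i % B + 1)) % T) ≤ (n + 1) * T

theorem holdsUpTo_iff_check (N : ℕ) : HoldsUpTo N ↔ Check N ((N + 2) ^ (2 * N)) := by
  have hB0 : 0 < (N + 2) ^ (2 * N) := by positivity
  have hB : ∀ n ≤ N, ((n + 1) ^ 2) ^ (n - 1) ≤ (N + 2) ^ (2 * N) := fun n hn => by
    rw [← pow_mul]
    exact (Nat.pow_le_pow_left (by omega) _).trans (Nat.pow_le_pow_right (by omega) (by omega))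
  generalize (N + 2) ^ (2 * N) = B at hB0 hB
  rw [holdsUpTo_iff_lonely]
  constructor
  · intro h n hn m hm
    set d : ℕ → ℕ := fun i => m / B ^ i % B + 1
    set S := (Finset.range (n + 1)).image d
    have h0 : 0 ∉ S := by simp [S, d]
    have hne : S.Nonempty := Finset.Nonempty.image (by simp) _
    have hcard : S.card ≤ n + 1 := by
      simpa using Finset.card_image_le (s := Finset.range (n + 1)) (f := d)
    have hL : Lonely S (1 / (((n + 1 : ℕ) : ℝ) + 1)) := (h S h0 hne (hcard.trans hn)).mono le_rfl
      (one_div_le_one_div_of_le (by positivity) (by gcongr))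
    obtain ⟨j, hj, t, ht, hcheck⟩ := hL.exists_rational h0 hne
    refine ⟨(n + 1 + 1) * j, ?_, t, ht, fun i hi => ?_⟩
    · obtain ⟨i, -, rfl⟩ := Finset.mem_image.1 hj
      have : d i ≤ B := Nat.mod_lt _ hB0
      nlinarith
    · exact hcheck (d i) (Finset.mem_image_of_mem _ (Finset.mem_range.2 hi))
  · intro h
    refine lonely_of_bounded hB fun S h0 hne hN hSB => ?_
    obtain ⟨n, hn⟩ : ∃ n, S.card = n + 1 := Nat.exists_eq_succ_of_ne_zero hne.card_pos.ne'
    let e := S.equivFinOfCardEq hn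
    have hpos : ∀ v ∈ S, 0 < v := fun v hv => Nat.pos_of_ne_zero fun h => h0 (h ▸ hv)
    let digit : Fin (n + 1) → Fin B := fun i => ⟨(e.symm i : ℕ) - 1, by
      have := hSB _ (e.symm i).2
      omega⟩
    let m := finFunctionFinEquiv digit
    have hm : ∀ i : Fin (n + 1), (m : ℕ) / B ^ (i : ℕ) % B + 1 = (e.symm i : ℕ) := fun i => by
      have h1 := congrArg Fin.val (congrFun (finFunctionFinEquiv.symm_apply_apply digit) i)
      rw [finFunctionFinEquiv_symm_apply_val] at h1
      have := hpos _ (e.symm i).2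
      rw [h1]
      change (e.symm i : ℕ) - 1 + 1 = _
      omega
    obtain ⟨T, -, t, ht, hcheck⟩ := h n (by omega) m
      (m.2.trans_le (Nat.pow_le_pow_right hB0 (by omega)))
    refine ⟨t / T, fun v hv => ?_⟩
    have := hcheck (e ⟨v, hv⟩) (e ⟨v, hv⟩).2
    rw [hm, Equiv.symm_apply_apply, ← le_norm_coe_div_iff (n := n + 1) (by omega : 0 < T)] at this
    rw [hn]
    convert this using 3
    push_cast
    ring

namespace Term

/-! ### Arithmetic terms -/

theorem eval_recur (n a f : Term) (l : List ℕ) :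
    eval (recur n a f) l = recurAt a f l (eval n l) := rfl

@[simp] theorem recurAt_zero (a f : Term) (l : List ℕ) : recurAt a f l 0 = eval a l := rfl

@[simp] theorem recurAt_succ (a f : Term) (l : List ℕ) (j : ℕ) :
    recurAt a f l (j + 1) = eval f (j :: recurAt a f l j :: l) := rfl

/-- The constant one. -/
def one : Term := succ zero

@[simp] theorem eval_one (l : List ℕ) : eval one l = 1 := rfl

/-- Addition. -/
def add (e f : Term) : Term := app (recur (var 1) (var 0) (succ (var 1))) e f

theorem recurAt_add (l : List ℕ) (j : ℕ) :
    recurAt (var 0) (succ (var 1)) l j = l.getD 0 0 + j := by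
  induction j with
  | zero => rfl
  | succ j ih => simp [eval, ih]; ring

theorem eval_add (e f : Term) (l : List ℕ) : eval (add e f) l = eval e l + eval f l := by
  rw [add, eval, eval_recur, recurAt_add]
  simp [eval]

theorem PolyBounded.one : PolyBounded one := PolyBounded.zero.succ

theorem PolyBounded.add {e f : Term} (he : PolyBounded e) (hf : PolyBounded f) :
    PolyBounded (add e f) := by
  refine PolyBounded.app (PolyBounded.recur (.var _) (.var _) (.succ (.var _))
    ⟨2, fun M hM l hl j hj => ?_⟩) he hf
  have h1 : j ≤ M := hj.trans (getD_le hl 1)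
  have h2 := getD_le hl 0
  rw [recurAt_add]
  nlinarith

/-- Truncated subtraction. -/
def sub (e f : Term) : Term := app (recur (var 1) (var 0) (recur (var 1) zero (var 0))) e f

theorem recurAt_sub (l : List ℕ) (j : ℕ) :
    recurAt (var 0) (recur (var 1) zero (var 0)) l j = l.getD 0 0 - j := by
  have pred : ∀ (l : List ℕ) (j : ℕ), recurAt zero (var 0) l j = j - 1 := fun l j => by
    cases j <;> simp [eval]
  induction j with
  | zero => rfl
  | succ j ih =>
    rw [recurAt_succ, eval_recur, pred, ih]
    simp [eval]
    omega

theorem eval_sub (e f : Term) (l : List ℕ) : eval (sub e f) l = eval e l - eval f l := by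
  rw [sub, eval, eval_recur, recurAt_sub]
  simp [eval]

theorem PolyBounded.sub {e f : Term} (he : PolyBounded e) (hf : PolyBounded f) :
    PolyBounded (sub e f) := by
  have pred : PolyBounded (.recur (.var 1) .zero (.var 0)) := by
    refine .recur (.var _) .zero (.var _) ⟨1, fun M hM l hl j hj => ?_⟩
    have h1 : j ≤ M := hj.trans (getD_le hl 1)
    cases j
    · simp [eval]
    · simpa [eval] using (Nat.le_succ _).trans h1
  refine PolyBounded.app (PolyBounded.recur (.var _) (.var _) pred
    ⟨1, fun M hM l hl j hj => ?_⟩) he hf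
  have h2 := getD_le hl 0
  rw [recurAt_sub, pow_one]
  omega

/-- Multiplication. -/
def mul (e f : Term) : Term := app (recur (var 1) zero (add (var 1) (var 2))) e f

theorem recurAt_mul (l : List ℕ) (j : ℕ) :
    recurAt zero (add (var 1) (var 2)) l j = l.getD 0 0 * j := by
  induction j with
  | zero => rfl
  | succ j ih => rw [recurAt_succ, eval_add]; simp [eval, ih]; ring

theorem eval_mul (e f : Term) (l : List ℕ) : eval (mul e f) l = eval e l * eval f l := by
  rw [mul, eval, eval_recur, recurAt_mul]
  simp [eval]

theorem PolyBounded.mul {e f : Term} (he : PolyBounded e) (hf : PolyBounded f) :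
    PolyBounded (mul e f) := by
  refine PolyBounded.app (PolyBounded.recur (.var _) .zero (.add (.var _) (.var _))
    ⟨2, fun M hM l hl j hj => ?_⟩) he hf
  have h1 : j ≤ M := hj.trans (getD_le hl 1)
  have h2 := getD_le hl 0
  rw [recurAt_mul]
  nlinarith

/-- Exponentiation. Its value is not polynomially bounded. -/
def pow (e f : Term) : Term := app (recur (var 1) one (mul (var 1) (var 2))) e f

theorem recurAt_pow (l : List ℕ) (j : ℕ) :
    recurAt one (mul (var 1) (var 2)) l j = l.getD 0 0 ^ j := by
  induction j with
  | zero => rfl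
  | succ j ih => rw [recurAt_succ, eval_mul]; simp [eval, ih]; ring

theorem eval_pow (e f : Term) (l : List ℕ) : eval (pow e f) l = eval e l ^ eval f l := by
  rw [pow, eval, eval_recur, recurAt_pow]
  simp [eval]

/-- The cost of a power is polynomially bounded in its base, its exponent and its value. -/
theorem exists_cost_pow_le {e f : Term} (he : PolyBounded e) (hf : PolyBounded f) :
    ∃ c : ℕ, ∀ M : ℕ, 2 ≤ M → ∀ l : List ℕ, (∀ x ∈ l, x ≤ M) → 0 < eval e l → eval e l ≤ M →
      eval f l ≤ M → eval (pow e f) l ≤ M → cost (pow e f) l ≤ M ^ c := by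
  obtain ⟨c₁, hc₁⟩ := he
  obtain ⟨c₂, hc₂⟩ := hf
  obtain ⟨c₃, hc₃⟩ := PolyBounded.mul (.var 1) (.var 2)
  obtain ⟨c, hcd⟩ : ∃ c, c = c₁ + c₂ + c₃ + 1 := ⟨_, rfl⟩
  refine ⟨c + 5, fun M hM l hl hx0 hx hy hxy => ?_⟩
  have h1 := (hc₁ M hM l hl).2
  have h2 := (hc₂ M hM l hl).2
  rw [eval_pow] at hxy
  set x := eval e l
  set y := eval f l
  have m1 : M ^ c₁ ≤ M ^ c := Nat.pow_le_pow_right (by omega) (by omega)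
  have m2 : M ^ c₂ ≤ M ^ c := Nat.pow_le_pow_right (by omega) (by omega)
  have m3 : M ^ c₃ ≤ M ^ c := Nat.pow_le_pow_right (by omega) (by omega)
  have o1 : 1 ≤ M ^ c := Nat.one_le_pow _ _ (by omega)
  have h3 : ∑ j ∈ Finset.range y, (cost (mul (var 1) (var 2))
      (j :: recurAt one (mul (var 1) (var 2)) [x, y] j :: [x, y]) + 3) ≤ M * (M ^ c + 3) := by
    calc _ ≤ ∑ j ∈ Finset.range y, (M ^ c + 3) := by
          refine Finset.sum_le_sum fun j hj => ?_
          have hj' : j < y := Finset.mem_range.1 hj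
          have hxj : x ^ j ≤ M := (Nat.pow_le_pow_right hx0 hj'.le).trans hxy
          have := (hc₃ M hM (j :: recurAt one (mul (var 1) (var 2)) [x, y] j :: [x, y]) (by
            simp only [recurAt_pow, List.mem_cons, forall_eq_or_imp, List.not_mem_nil,
              false_imp_iff, implies_true, and_true]
            exact ⟨by omega, hxj, hx, hy⟩)).2
          omega
      _ = y * (M ^ c + 3) := by simp
      _ ≤ _ := Nat.mul_le_mul_right _ hy
  have h4 : 2 * M ^ c + 8 + M * (M ^ c + 3) ≤ M ^ (c + 5) := by
    have h16 : 16 ≤ M ^ 4 := Nat.pow_le_pow_left hM 4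
    have : M ^ (c + 5) = M ^ c * M * M ^ 4 := by ring
    rw [this]
    have p1 : M ≤ M ^ c * M := Nat.le_mul_of_pos_left _ o1
    have p2 := Nat.mul_le_mul_left (M ^ c) hM
    have p3 := Nat.mul_le_mul_left (M ^ c * M) h16
    nlinarith
  have hcost : cost (pow e f) l = cost e l + cost f l + (1 + 2 + 4 + ∑ j ∈ Finset.range y,
      (cost (mul (var 1) (var 2)) (j :: recurAt one (mul (var 1) (var 2)) [x, y] j :: [x, y]) + 3))
      + 1 := rfl
  omega

/-- Remainder, counting up cyclically; the value for divisor zero is `0`. -/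
def mod (e f : Term) : Term :=
  app (recur (var 0) zero (mul (succ (var 1)) (sub one (sub one (sub (var 3) (succ (var 1))))))) e f

theorem recurAt_mod (l : List ℕ) (hl : 0 < l.getD 1 0) (j : ℕ) :
    recurAt zero (mul (succ (var 1)) (sub one (sub one (sub (var 3) (succ (var 1)))))) l j =
      j % l.getD 1 0 := by
  induction j with
  | zero => simp [eval]
  | succ j ih =>
    rw [recurAt_succ, eval_mul, eval_sub, eval_sub, eval_sub]
    simp only [eval, eval_one, List.getD_cons_succ, List.getD_cons_zero, ih]
    set m := l.getD 1 0
    have hlt := Nat.mod_lt j hl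
    rw [Nat.add_mod j 1 m]
    rcases Nat.lt_or_ge (j % m + 1) m with h | h
    · have h1 : 1 % m = 1 := Nat.mod_eq_of_lt (by omega)
      rw [h1, Nat.mod_eq_of_lt h]
      have : 1 - (1 - (m - (j % m + 1))) = 1 := by omega
      rw [this, mul_one]
    · have h1 : j % m + 1 = m := by omega
      rw [Nat.add_mod_mod, h1, Nat.mod_self]
      simp

theorem eval_mod (e f : Term) (l : List ℕ) (hf : 0 < eval f l) :
    eval (mod e f) l = eval e l % eval f l := by
  rw [mod, eval, eval_recur, recurAt_mod]
  · simp [eval]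
  · simpa using hf

theorem PolyBounded.mod {e f : Term} (he : PolyBounded e) (hf : PolyBounded f) :
    PolyBounded (mod e f) := by
  refine PolyBounded.app (PolyBounded.recur (.var _) .zero (.mul (.succ (.var _))
    (.sub .one (.sub .one (.sub (.var _) (.succ (.var _)))))) ⟨1, fun M hM l hl j hj => ?_⟩) he hf
  have h1 : j ≤ M := hj.trans (getD_le hl 0)
  rw [pow_one]
  refine le_trans ?_ h1
  clear h1 hj
  induction j with
  | zero => simp [eval]
  | succ j ih =>
    rw [recurAt_succ, eval_mul, eval_sub]
    simp only [eval, eval_one, List.getD_cons_succ, List.getD_cons_zero]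
    exact (Nat.mul_le_mul (Nat.succ_le_succ ih) (Nat.sub_le _ _)).trans (by simp)

/-- Quotient, counting the multiples of the divisor. -/
def div (e f : Term) : Term :=
  app (recur (var 0) zero (add (var 1) (sub one (mod (succ (var 0)) (var 3))))) e f

theorem recurAt_div (l : List ℕ) (hl : 0 < l.getD 1 0) (j : ℕ) :
    recurAt zero (add (var 1) (sub one (mod (succ (var 0)) (var 3)))) l j = j / l.getD 1 0 := by
  induction j with
  | zero => simp [eval]
  | succ j ih =>
    rw [recurAt_succ, eval_add, eval_sub, eval_mod _ _ _ (by simpa [eval] using hl)]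
    simp only [eval, eval_one, List.getD_cons_succ, List.getD_cons_zero, ih, Nat.succ_div]
    split_ifs with h
    · rw [Nat.mod_eq_zero_of_dvd h]
    · have := Nat.pos_of_ne_zero fun h0 => h (Nat.dvd_of_mod_eq_zero h0)
      omega

theorem eval_div (e f : Term) (l : List ℕ) (hf : 0 < eval f l) :
    eval (div e f) l = eval e l / eval f l := by
  rw [div, eval, eval_recur, recurAt_div]
  · simp [eval]
  · simpa using hf

theorem recurAt_div_le (l : List ℕ) (j : ℕ) :
    recurAt zero (add (var 1) (sub one (mod (succ (var 0)) (var 3)))) l j ≤ j := by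
  induction j with
  | zero => simp [eval]
  | succ j ih =>
    rw [recurAt_succ, eval_add, eval_sub]
    simp only [eval, eval_one, List.getD_cons_succ, List.getD_cons_zero]
    omega

theorem eval_div_le (e f : Term) (l : List ℕ) : eval (div e f) l ≤ eval e l :=
  recurAt_div_le _ _

theorem PolyBounded.div {e f : Term} (he : PolyBounded e) (hf : PolyBounded f) :
    PolyBounded (div e f) := by
  refine PolyBounded.app (PolyBounded.recur (.var _) .zero (.add (.var _)
    (.sub .one (.mod (.succ (.var _)) (.var _)))) ⟨1, fun M hM l hl j hj => ?_⟩) he hf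
  rw [pow_one]
  exact (recurAt_div_le l j).trans (hj.trans (getD_le hl 0))

/-- Truncation of `e / b ^ i`, by repeated division; `b` sees the number of the round and the current
value in front of the environment. -/
def shiftRight (e i b : Term) : Term := recur i e (div (var 1) b)

theorem eval_shiftRight (e i b : Term) (l : List ℕ) (B : ℕ) (hB : 0 < B)
    (hb : ∀ x y, eval b (x :: y :: l) = B) :
    eval (shiftRight e i b) l = eval e l / B ^ eval i l := by
  rw [shiftRight, eval_recur]
  induction eval i l with
  | zero => simp
  | succ j ih =>
    rw [recurAt_succ, eval_div _ _ _ (by rw [hb]; exact hB), hb]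
    simp only [eval, List.getD_cons_succ, List.getD_cons_zero, ih]
    rw [Nat.div_div_eq_div_mul, pow_succ]

theorem PolyBounded.shiftRight {e i b : Term} (he : PolyBounded e) (hi : PolyBounded i)
    (hb : PolyBounded b) : PolyBounded (shiftRight e i b) := by
  refine .recur hi he (.div (.var _) hb) ?_
  obtain ⟨c, hc⟩ := he
  refine ⟨c, fun M hM l hl j hj => le_trans ?_ (hc M hM l hl).1⟩
  clear hj
  induction j with
  | zero => simp
  | succ j ih =>
    rw [recurAt_succ]
    refine (eval_div_le _ _ _).trans ?_
    simpa [eval] using ih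

/-- Comparison `e ≤ f`, as a truth value: zero means false. -/
def le (e f : Term) : Term := sub one (sub e f)

theorem eval_le_ne_zero (e f : Term) (l : List ℕ) :
    eval (le e f) l ≠ 0 ↔ eval e l ≤ eval f l := by
  rw [le, eval_sub, eval_sub]
  simp only [eval_one]
  omega

theorem PolyBounded.le {e f : Term} (he : PolyBounded e) (hf : PolyBounded f) :
    PolyBounded (le e f) := .sub .one (.sub he hf)

/-- Bounded universal quantification over `x < e`; `f` sees `x` at index `0`, and an auxiliary value
at index `1`. -/
def all (e f : Term) : Term := recur e one (sub (var 1) (sub one f))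

theorem recurAt_all_le (f : Term) (l : List ℕ) (j : ℕ) :
    recurAt one (sub (var 1) (sub one f)) l j ≤ 1 := by
  induction j with
  | zero => simp
  | succ j ih =>
    rw [recurAt_succ, eval_sub]
    exact (Nat.sub_le _ _).trans (by simpa [eval] using ih)

theorem eval_all_le (e f : Term) (l : List ℕ) : eval (all e f) l ≤ 1 := recurAt_all_le f l _

theorem eval_all_ne_zero {e f : Term} {l : List ℕ} {P : ℕ → Prop}
    (h : ∀ x < eval e l, ∀ y, eval f (x :: y :: l) ≠ 0 ↔ P x) :
    eval (all e f) l ≠ 0 ↔ ∀ x < eval e l, P x := by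
  rw [all, eval_recur]
  generalize eval e l = n at h
  induction n with
  | zero => simp
  | succ j ih =>
    have hle := recurAt_all_le f l j
    rw [recurAt_succ, eval_sub, eval_sub, Nat.forall_lt_succ_right,
      ← ih fun x hx => h x (hx.trans j.lt_succ_self),
      ← h j j.lt_succ_self (recurAt one (sub (var 1) (sub one f)) l j)]
    simp only [eval, eval_one, List.getD_cons_succ, List.getD_cons_zero]
    omega

theorem PolyBounded.all {e f : Term} (he : PolyBounded e) (hf : PolyBounded f) :
    PolyBounded (all e f) :=
  .recur he .one (.sub (.var _) (.sub .one hf))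
    ⟨1, fun M hM l _ j _ => (recurAt_all_le f l j).trans (by rw [pow_one]; omega)⟩

/-- Bounded existential quantification over `x < e`; `f` sees `x` at index `0`, and an auxiliary
value at index `1`. -/
def ex (e f : Term) : Term := sub one (all e (sub one f))

theorem eval_ex_ne_zero {e f : Term} {l : List ℕ} {P : ℕ → Prop}
    (h : ∀ x < eval e l, ∀ y, eval f (x :: y :: l) ≠ 0 ↔ P x) :
    eval (ex e f) l ≠ 0 ↔ ∃ x < eval e l, P x := by
  have h1 : eval (all e (sub one f)) l ≠ 0 ↔ ∀ x < eval e l, ¬ P x :=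
    eval_all_ne_zero fun x hx y => by
      rw [← h x hx y, eval_sub]
      simp only [eval_one]
      omega
  have h2 := eval_all_le e (sub one f) l
  have h3 : eval (ex e f) l ≠ 0 ↔ ¬ eval (all e (sub one f)) l ≠ 0 := by
    rw [ex, eval_sub]
    simp only [eval_one]
    omega
  rw [h3, h1]
  push Not
  rfl

theorem PolyBounded.ex {e f : Term} (he : PolyBounded e) (hf : PolyBounded f) :
    PolyBounded (ex e f) := .sub .one (.all he (.sub .one hf))

/-! ### The program -/

/-- The last line of the check, for a remainder `r`: the environment is
`[r, i, _, t, _, T, _, m, _, n, _, B ^ N, B, N]`. -/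
def checkRemainder : Term :=
  mul (le (var 5) (mul (succ (succ (var 9))) (var 0)))
    (le (mul (succ (succ (var 9))) (var 0)) (mul (succ (var 9)) (var 5)))

/-- The term for `Check N B` in the environment `[B ^ N, B, N]`. -/
def check : Term :=
  all (var 2) (all (var 2) (ex (mul (succ (succ (var 6))) (var 5)) (ex (var 0) (all (succ (var 6))
    (bind (mod (mul (var 2) (succ (mod (shiftRight (var 6) (var 0) (var 13)) (var 11)))) (var 4))
      checkRemainder)))))

theorem polyBounded_check : PolyBounded check := by
  refine .all (.var _) (.all (.var _) (.ex (.mul (.succ (.succ (.var _))) (.var _)) (.ex (.var _)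
    (.all (.succ (.var _)) (.bind (.mod (.mul (.var _) (.succ (.mod
      (.shiftRight (.var _) (.var _) (.var _)) (.var _)))) (.var _)) ?_)))))
  exact .mul (.le (.var _) (.mul (.succ (.succ (.var _))) (.var _)))
    (.le (.mul (.succ (.succ (.var _))) (.var _)) (.mul (.succ (.var _)) (.var _)))

theorem eval_check_ne_zero (N B : ℕ) (hB : 0 < B) :
    eval check [B ^ N, B, N] ≠ 0 ↔ Check N B := by
  refine eval_all_ne_zero fun n _ _ => eval_all_ne_zero fun m _ _ => ?_
  -- the bound `(N + 2) * B` on the denominator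
  have hU : ∀ l : List ℕ, eval (mul (succ (succ (var 6))) (var 5)) l =
      (l.getD 6 0 + 2) * l.getD 5 0 := fun l => eval_mul _ _ _
  refine (eval_ex_ne_zero fun T _ _ => eval_ex_ne_zero fun t ht _ =>
    eval_all_ne_zero fun i _ _ => ?_).trans (by rw [hU]; rfl)
  rw [eval, eval_mod _ _ _ (by exact (Nat.zero_le t).trans_lt ht), eval_mul, eval.eq_3,
    eval_mod _ _ _ (by exact hB), eval_shiftRight _ _ _ _ B hB fun _ _ => rfl]
  simp only [eval, List.getD_cons_succ, List.getD_cons_zero]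
  rw [checkRemainder, eval_mul, mul_ne_zero_iff, eval_le_ne_zero, eval_le_ne_zero, eval_mul,
    eval_mul]
  rfl

/-- The term that decides the conjecture, in the environment `[N]`. -/
def decision : Term :=
  bind (pow (succ (succ (var 0))) (add (var 0) (var 0))) (bind (pow (var 0) (var 1)) check)

theorem eval_decision (N : ℕ) : eval decision [N] =
    eval check [((N + 2) ^ (2 * N)) ^ N, (N + 2) ^ (2 * N), N] := by
  simp only [decision, eval, eval_pow, eval_add, List.getD_cons_zero, List.getD_cons_succ, two_mul]

theorem eval_decision_ne_zero (N : ℕ) : eval decision [N] ≠ 0 ↔ HoldsUpTo N := by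
  rw [eval_decision, eval_check_ne_zero _ _ (by positivity), holdsUpTo_iff_check]

/-- All numbers that occur are polynomially bounded in `(N + 2) ^ (2 * N ^ 2 + 2)`, and hence so is
the cost. -/
theorem exists_cost_decision_le :
    ∃ c : ℕ, ∀ N : ℕ, cost decision [N] ≤ ((N + 2) ^ (2 * N ^ 2 + 2)) ^ c := by
  obtain ⟨c₁, h₁⟩ := exists_cost_pow_le (.succ (.succ (.var 0))) (.add (.var 0) (.var 0))
  obtain ⟨c₂, h₂⟩ := exists_cost_pow_le (.var 0) (.var 1)
  obtain ⟨c₃, h₃⟩ := polyBounded_check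
  refine ⟨c₁ + c₂ + c₃ + 3, fun N => ?_⟩
  set M := (N + 2) ^ (2 * N ^ 2 + 2)
  set B := (N + 2) ^ (2 * N)
  have hM : N + 2 ≤ M := Nat.le_self_pow (by omega) _
  have hN2 : N + N ≤ M := by
    have : (N + 2) ^ 2 ≤ M := Nat.pow_le_pow_right (by omega) (by omega)
    nlinarith
  have hB : B ≤ M := Nat.pow_le_pow_right (by omega) (by nlinarith)
  have hW : B ^ N ≤ M := by
    rw [← pow_mul]
    exact Nat.pow_le_pow_right (by omega) (by nlinarith)
  have e1 : eval (pow (succ (succ (var 0))) (add (var 0) (var 0))) [N] = B := by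
    rw [eval_pow, eval_add]
    simp only [eval, List.getD_cons_zero, B, two_mul]
  have e2 : eval (pow (var 0) (var 1)) [B, N] = B ^ N := eval_pow _ _ _
  have g1 := h₁ M (by omega) [N] (by simp; omega) (by simp [eval])
    (by exact hM) (by rw [eval_add]; simpa [eval] using hN2) (by rw [e1]; exact hB)
  have g2 := h₂ M (by omega) [B, N] (by simp; omega) (by simp [eval, B])
    (by simpa [eval] using hB) (by simp [eval]; omega) (by rw [e2]; exact hW)
  have g3 := (h₃ M (by omega) [B ^ N, B, N] (by simp; omega)).2
  have hcost : cost decision [N] = cost (pow (succ (succ (var 0))) (add (var 0) (var 0))) [N] +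
      (cost (pow (var 0) (var 1)) [B, N] + cost check [B ^ N, B, N] + 1) + 1 := by
    rw [← e2, ← e1]
    rfl
  rw [hcost, pow_add]
  have m1 : M ^ c₁ ≤ M ^ (c₁ + c₂ + c₃) := Nat.pow_le_pow_right (by omega) (by omega)
  have m2 : M ^ c₂ ≤ M ^ (c₁ + c₂ + c₃) := Nat.pow_le_pow_right (by omega) (by omega)
  have m3 : M ^ c₃ ≤ M ^ (c₁ + c₂ + c₃) := Nat.pow_le_pow_right (by omega) (by omega)
  have m4 : 2 ^ 3 ≤ M ^ 3 := Nat.pow_le_pow_left (by omega) 3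
  have m5 : 1 ≤ M ^ (c₁ + c₂ + c₃) := Nat.one_le_pow _ _ (by omega)
  have m6 := Nat.mul_le_mul_left (M ^ (c₁ + c₂ + c₃)) m4
  omega

end Term

theorem exists_pow_bound (c : ℕ) : ∃ C : ℕ, ∀ n : ℕ, 1 ≤ n →
    ((n + 2) ^ (2 * n ^ 2 + 2)) ^ c ≤ C * n ^ (C * n ^ 2) := by
  -- `81 ^ c` is the left-hand side at `n = 1`; for `n ≥ 2`, `n + 2 ≤ n ^ 2`
  refine ⟨81 ^ c + 8 * c, fun n hn => ?_⟩
  have hC : 1 ≤ 81 ^ c := Nat.one_le_pow _ _ (by norm_num)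
  rcases hn.eq_or_lt with rfl | hn
  · simp
  · have h1 : n + 2 ≤ n ^ 2 := by nlinarith
    calc ((n + 2) ^ (2 * n ^ 2 + 2)) ^ c ≤ ((n ^ 2) ^ (2 * n ^ 2 + 2)) ^ c :=
          Nat.pow_le_pow_left (Nat.pow_le_pow_left h1 _) _
      _ = n ^ ((2 * (2 * n ^ 2 + 2)) * c) := by rw [← pow_mul, ← pow_mul]; ring_nf
      _ ≤ n ^ ((81 ^ c + 8 * c) * n ^ 2) := by
          refine Nat.pow_le_pow_right (by omega) ?_
          have : 2 * (2 * n ^ 2 + 2) ≤ 8 * n ^ 2 := by nlinarith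
          nlinarith [Nat.mul_le_mul_right c this]
      _ ≤ _ := Nat.le_mul_of_pos_left _ (by omega)

end LonelyRunner

theorem mainTheorem3 :
    ComputablePred LonelyRunner.HoldsUpTo ∧
    ∃ p : LonelyRunner.LoopProgram, p.size ≤ 10000 ∧
      (∀ n₀ : ℕ, 1 ≤ n₀ →
        (LonelyRunner.HoldsUpTo n₀ → p.output n₀ = 1) ∧
        (¬ LonelyRunner.HoldsUpTo n₀ → p.output n₀ = 0)) ∧
      ∃ C : ℕ, ∀ n₀ : ℕ, 1 ≤ n₀ → p.time n₀ ≤ C * n₀ ^ (C * n₀ ^ 2) := by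
  open LonelyRunner LonelyRunner.Term in
  have hiff := eval_decision_ne_zero
  have hspec := fun N : ℕ => compile_spec decision [0] 1 (LoopProgram.init N) (by simp)
  have hinit : ∀ N : ℕ, [0].map (LoopProgram.init N) = [N] := fun N => by
    simp [LoopProgram.init]
  simp only [hinit] at hspec
  refine ⟨?_, compile decision [0] 1, by decide +kernel, fun N _ => ?_, ?_⟩
  · have hprim : Primrec fun N : ℕ => eval decision [N] :=
      (primrec_eval decision).comp (Primrec.list_cons.comp Primrec.id (Primrec.const []))
    have hpred : PrimrecPred fun N : ℕ => eval decision [N] ≠ 0 :=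
      (Primrec.eq.comp hprim (Primrec.const 0)).not
    exact (hpred.of_eq hiff).computablePred
  · have hout : (compile decision [0] 1).output N = eval decision [N] := (hspec N).1
    rw [hout]
    have hle : eval decision [N] ≤ 1 := by
      rw [eval_decision]
      exact eval_all_le _ _ _
    have := hiff N
    refine ⟨fun h => ?_, fun h => ?_⟩
    · have := this.2 h
      omega
    · by_contra h0
      exact h (this.1 h0)
  · obtain ⟨c, hc⟩ := exists_cost_decision_le
    obtain ⟨C, hC⟩ := exists_pow_bound c
    refine ⟨C, fun N hN => ?_⟩
    have htime : (compile decision [0] 1).time N = cost decision [N] := (hspec N).2.2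
    rw [htime]
    exact (hc N).trans (hC N hN)
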